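/- Let $\mathrm{Col}$ be a finite totally ordered set of colors, and let $t, x_i, x_j, y$ be elements of a commutative ring (for instance indeterminates), with $y$ invertible where $y^{-1}$ occurs. A horizontal edge is labeled by an element of $\mathrm{Col}\sqcup\{+\}$, a vertical edge by a subset of $\mathrm{Col}$. For $\Sigma\subseteq\mathrm{Col}$ and colors $c<d$ let $\Sigma_{<c}$, $\Sigma_{>c}$, $\Sigma_{(c,d)}$ be the number of $e\in\Sigma$ with $e<c$, $e>c$, $c<e<d$ respectively, and let $\Sigma_c\in\{0,1\}$ be the multiplicity of $c$ in $\Sigma$. *T-vertices.* A T-vertex with row parameter $x$ and column parameter $y$ has four edges, labeled (left, top, right, bottom). Its Whittaker weight and its K-theoretic weight are given by the following table, and are $0$ for every configuration not listed. Here $c$ is a color in cases 2–4, and $c<d$ are colors in cases 5 and 6. 1. $(+,\Sigma,+,\Sigma)$: both weights are $(-t)^{|\Sigma|}$. 2. $(c,\Sigma,c,\Sigma)$: Whittaker $t^{\Sigma_{>c}}(x+t^{\Sigma_c}y)$; K-theoretic $t^{\Sigma_{>c}}(-xy^{-1}+t^{\Sigma_c})$. 3. $(+,\Sigma,c,\Sigma\setminus\{c\})$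 with $c\in\Sigma$: both weights are $(-t)^{\Sigma_{<c}}t^{\Sigma_{>c}}$. 4. $(c,\Sigma,+,\Sigma\cup\{c\})$ with $c\notin\Sigma$: Whittaker $(1-t)x(-t)^{\Sigma_{>c}}$; K-theoretic $(t-1)xy^{-1}(-t)^{\Sigma_{>c}}$. 5. $(c,\Sigma,d,(\Sigma\cup\{c\})\setminus\{d\})$ with $c\notin\Sigma$, $d\in\Sigma$: Whittaker $(1-t)x(-t)^{\Sigma_{(c,d)}}t^{\Sigma_{>d}}$; K-theoretic $(t-1)xy^{-1}(-t)^{\Sigma_{(c,d)}}t^{\Sigma_{>d}}$. 6. $(d,\Sigma,c,(\Sigma\cup\{d\})\setminus\{c\})$ with $d\notin\Sigma$, $c\in\Sigma$: Whittaker $-(1-t)y(-1)^{\Sigma_{(c,d)}}t^{\Sigma_{>d}}$; K-theoretic $(t-1)(-1)^{\Sigma_{(c,d)}}t^{\Sigma_{>d}}$. *R-vertices.* At the R-vertex the row with parameter $x_i$ runs from lower left to upper right and the row with parameter $x_j$ from upper left to lower right. For edge labels (lower left, upper left, upper right, lower right), and with $c<d$ colors and $g$ any color, the weight $R$ is $$R(+,+,+,+)=x_j-tx_i,\qquad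 R(g,g,g,g)=x_i-tx_j,$$ $$R(g,+,g,+)=x_i-x_j,\quad R(+,g,+,g)=t(x_i-x_j),\quad R(g,+,+,g)=(1-t)x_i,\quad R(+,g,g,+)=(1-t)x_j,$$ $$R(d,c,d,c)=x_i-x_j,\quad R(c,d,c,d)=t(x_i-x_j),\quad R(c,d,d,c)=(1-t)x_i,\quad R(d,c,c,d)=(1-t)x_j,$$ and $R=0$ for every configuration not listed. **Theorem.** Let $T_x$ denote the weight of a T-vertex with parameters $x,y$: either the Whittaker weight for all the T-vertices, or (if $y$ is invertible) the K-theoretic weight for all of them. Then the Yang–Baxter equation holds: for all $a,b,d,e\in\mathrm{Col}\sqcup\{+\}$ and all $c,f\subseteq\mathrm{Col}$, $$\sum_{u,v,m}R(a,b,u,v)\,T_{x_i}(u,c,d,m)\,T_{x_j}(v,m,e,f)=\sum_{u,v,m}T_{x_j}(b,c,v,m)\,T_{x_i}(a,m,u,f)\,R(u,v,d,e),$$ where both sums run over $u,v\in\mathrm{Col}\sqcup\{+\}$ and $m\subseteq\mathrm{Col}$. (The left side is the partition function of the configuration with the R-vertex to the left of the two T-vertices, the right side that of the configuration with the R-vertex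 to their right; the boundary edges are $a$ lower left, $b$ upper left, $c$ top, $d$ upper right, $e$ lower right, $f$ bottom.) -/

import Mathlib

/-! Colored vertex weights, R-weights and the Yang-Baxter equation.

`C` is the finite totally ordered set of colors.  A horizontal edge carries an element of `Option C`
(`none` is the uncolored label `+`, `some c` the color `c`); a vertical edge carries a set of colors.
Whatever configuration is not listed has weight zero, so that a sum over all labellings of the
interior edges is the sum over the admissible states. -/

namespace ColoredLattice

variable {C : Type*} [LinearOrder C] {A : Type*} [CommRing A]

/-- The number of colors of `S` that are smaller than `c`. -/
def numBelow (S : Finset C) (c : C) : ℕ := (S.filter fun e => e < c).card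

/-- The number of colors of `S` that are larger than `c`. -/
def numAbove (S : Finset C) (c : C) : ℕ := (S.filter fun e => c < e).card

/-- The number of colors of `S` strictly between `c` and `d`. -/
def numBetween (S : Finset C) (c d : C) : ℕ := (S.filter fun e => c < e ∧ e < d).card

/-- The multiplicity (0 or 1) of the color `c` in `S`. -/
def mult (S : Finset C) (c : C) : ℕ := if c ∈ S then 1 else 0

/-- Whittaker weight of a T-vertex with row parameter `x` and column parameter `y`, whose edges
carry, in this order, the labels left, top, right, bottom. -/
def whittakerWeight (t x y : A) : Option C → Finset C → Option C → Finset C → A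
  | none, S, none, S' => if S' = S then (-t) ^ S.card else 0
  | some c, S, none, S' =>
      if c ∉ S ∧ S' = insert c S then (1 - t) * x * (-t) ^ numAbove S c else 0
  | none, S, some c, S' =>
      if c ∈ S ∧ S' = S.erase c then (-t) ^ numBelow S c * t ^ numAbove S c else 0
  | some c, S, some d, S' =>
      if c = d then
        if S' = S then t ^ numAbove S c * (x + t ^ mult S c * y) else 0
      else if c ∉ S ∧ d ∈ S ∧ S' = (insert c S).erase d then
        if c < d then (1 - t) * x * (-t) ^ numBetween S c d * t ^ numAbove S d
        else -(1 - t) * y * (-1) ^ numBetween S d c * t ^ numAbove S c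
      else 0

/-- K-theoretic weight of a T-vertex with row parameter `x` and (invertible) column parameter `y`,
whose edges carry, in this order, the labels left, top, right, bottom. -/
def kTheoreticWeight (t x : A) (y : Aˣ) : Option C → Finset C → Option C → Finset C → A
  | none, S, none, S' => if S' = S then (-t) ^ S.card else 0
  | some c, S, none, S' =>
      if c ∉ S ∧ S' = insert c S then
        (t - 1) * (x * (y⁻¹ : Aˣ)) * (-t) ^ numAbove S c else 0
  | none, S, some c, S' =>
      if c ∈ S ∧ S' = S.erase c then (-t) ^ numBelow S c * t ^ numAbove S c else 0
  | some c, S, some d, S' =>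
      if c = d then
        if S' = S then t ^ numAbove S c * (-(x * (y⁻¹ : Aˣ)) + t ^ mult S c) else 0
      else if c ∉ S ∧ d ∈ S ∧ S' = (insert c S).erase d then
        if c < d then (t - 1) * (x * (y⁻¹ : Aˣ)) * (-t) ^ numBetween S c d * t ^ numAbove S d
        else (t - 1) * (-1) ^ numBetween S d c * t ^ numAbove S c
      else 0

/-- Weight of the R-vertex at which the row with parameter `x` runs from the lower left to the
upper right and the row with parameter `x'` from the upper left to the lower right.  The labels are
those of the edges lower left, upper left, upper right, lower right, in this order. -/
def rWeight (t x x' : A) : Option C → Option C → Option C → Option C → A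
  | none, none, none, none => x' - t * x
  | some c, none, some d, none => if c = d then x - x' else 0
  | none, some c, none, some d => if c = d then t * (x - x') else 0
  | some c, none, none, some d => if c = d then (1 - t) * x else 0
  | none, some c, some d, none => if c = d then (1 - t) * x' else 0
  | some a, some b, some u, some v =>
      if a = b then
        if u = a ∧ v = a then x - t * x' else 0
      else if u = a ∧ v = b then
        if a < b then t * (x - x') else x - x'
      else if u = b ∧ v = a then
        if a < b then (1 - t) * x else (1 - t) * x'
      else 0
  | _, _, _, _ => 0

section PartitionFunctions

variable [Fintype C]

/-- Partition function of the three-vertex configuration with the R-vertex on the left of the two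
T-vertices.  `T₁` is the upper and `T₂` the lower T-vertex.  Boundary labels: `a` lower left,
`b` upper left, `c` top, `d` upper right, `e` lower right, `f` bottom.  The interior labels are `u`
(R-vertex to upper T-vertex), `v` (R-vertex to lower T-vertex), `m` (between the T-vertices). -/
def leftPartition (R : Option C → Option C → Option C → Option C → A)
    (T₁ T₂ : Option C → Finset C → Option C → Finset C → A)
    (a b : Option C) (c : Finset C) (d e : Option C) (f : Finset C) : A :=
  ∑ u : Option C, ∑ v : Option C, ∑ m : Finset C, R a b u v * T₁ u c d m * T₂ v m e f

/-- Partition function of the three-vertex configuration with the R-vertex on the right of the two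
T-vertices.  `T₂` is now the upper and `T₁` the lower T-vertex; the boundary labels are placed as in
`leftPartition`.  The interior labels are `u` (lower T-vertex to R-vertex), `v` (upper T-vertex to
R-vertex), `m` (between the T-vertices). -/
def rightPartition (R : Option C → Option C → Option C → Option C → A)
    (T₁ T₂ : Option C → Finset C → Option C → Finset C → A)
    (a b : Option C) (c : Finset C) (d e : Option C) (f : Finset C) : A :=
  ∑ u : Option C, ∑ v : Option C, ∑ m : Finset C, T₂ b c v m * T₁ a m u f * R u v d e

/-- The Yang-Baxter equation: both configurations have the same partition function, for every choice
of the six boundary labels. -/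
def YangBaxter (R : Option C → Option C → Option C → Option C → A)
    (T₁ T₂ : Option C → Finset C → Option C → Finset C → A) : Prop :=
  ∀ (a b : Option C) (c : Finset C) (d e : Option C) (f : Finset C),
    leftPartition R T₁ T₂ a b c d e f = rightPartition R T₁ T₂ a b c d e f

end PartitionFunctions

end ColoredLattice

/-! Color conservation leaves few states: the R-vertex either passes its two labels straight through
or exchanges them, and the edge between the T-vertices is forced. The Yang–Baxter equation thus
becomes the four-term identity `pair_yangBaxter`, or `0 = 0` when the boundary violates
conservation.

The number of colors is arbitrary, but a T-weight is an amplitude times a product over the colors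
`q` of the top edge, where each `q` other than the right label contributes a function of the left
label times a function of the right label. All four terms have the same two left labels and the same
two right labels, up to order. Hence every color off the horizontal boundary contributes equally to
all of them and factors out. What remains, `local_yangBaxter`, involves at most four labels and is a
finite check.

The label `+` is placed at the bottom, but the clauses `r = ⊥` and `b = ⊥` make it act as the
largest label on the right of a T-vertex and in exchanges at the R-vertex.

The K-theoretic weight is the Whittaker weight at `-y`, times `-y⁻¹` when the left label is a color.
The R-vertex only permutes labels, so these factors are the same on both sides. -/

namespace ColoredLattice

/-! ### The identity for the boundary colors -/

section Local

variable {D : Type*} [LinearOrder D] {A : Type*} [CommRing A]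

/-- Both orientations are recorded so that simplification with the hypotheses decides every `if`,
whichever way its condition is written. -/
lemma eq_or_ne_and_ne {α : Type*} (a b : α) : a = b ∨ (a ≠ b ∧ b ≠ a) :=
  (eq_or_ne a b).imp_right fun h => ⟨h, h.symm⟩

lemma lt_and_not_gt_or {a b : D} (h : a ≠ b) : (a < b ∧ ¬ b < a) ∨ (b < a ∧ ¬ a < b) :=
  h.lt_or_gt.imp (fun h => ⟨h, h.not_gt⟩) (fun h => ⟨h, h.not_gt⟩)

/-- The labels may coincide, so each one is counted only at its last occurrence. -/
lemma prod_quadruple (f : D → A) (a b d e : D) :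
    ∏ q ∈ ({a, b, d, e} : Finset D), f q =
      (if a = b ∨ a = d ∨ a = e then 1 else f a) * ((if b = d ∨ b = e then 1 else f b) *
        ((if d = e then 1 else f d) * f e)) := by
  have insert_prod (p : D) (s : Finset D) :
      ∏ q ∈ insert p s, f q = (if p ∈ s then 1 else f p) * ∏ q ∈ s, f q := by
    split_ifs with h
    · rw [Finset.insert_eq_of_mem h, one_mul]
    · rw [Finset.prod_insert h]
  simp only [insert_prod, Finset.prod_singleton, Finset.mem_insert, Finset.mem_singleton]

variable [OrderBot D]

/-- The part, depending only on the left label `l`, of the factor that a color `q` of the top edge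
contributes to the weight of a T-vertex.  The label `+` is the bottom element. -/
def leftFactor (t : A) (l q : D) : A := if l < q then t else if q < l then -1 else 1

/-- The part, depending only on the right label `r`, of the factor that a color `q` of the top edge
contributes to the weight of a T-vertex. -/
def rightFactor (r q : D) : A := if r = ⊥ ∨ q < r then -1 else 1

/-- The factor that a color `q` of the top edge contributes to the weight of a T-vertex. -/
def siteFactor (t : A) (l r q : D) : A :=
  if r = q then 1 else leftFactor t l q * rightFactor r q

/-- The part of the Whittaker weight that is not a product over the colors of the top edge. -/
def amplitude (t x y : A) (l : D) (S : Finset D) (r : D) : A :=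
  if l = ⊥ then 1
  else if l = r then x + (if l ∈ S then t else 1) * y
  else if r = ⊥ ∨ l < r then (1 - t) * x else -(1 - t) * y

/-- The labels left, top, right of a T-vertex can be completed to a configuration that obeys color
conservation. -/
def Admissible (l : D) (S : Finset D) (r : D) : Prop :=
  l = r ∨ (l ∉ S ∧ (r = ⊥ ∨ r ∈ S))

instance (l : D) (S : Finset D) (r : D) : Decidable (Admissible l S r) :=
  inferInstanceAs (Decidable (_ ∨ _))

/-- The bottom label of an admissible T-vertex. -/
def nextSet (l : D) (S : Finset D) (r : D) : Finset D :=
  if l = r then S else ((insert l S).erase r).erase ⊥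

lemma mem_nextSet {l r q : D} {S : Finset D} :
    q ∈ nextSet l S r ↔ if l = r then q ∈ S else q ≠ ⊥ ∧ q ≠ r ∧ (q = l ∨ q ∈ S) := by
  unfold nextSet
  split_ifs <;> simp

/-- The part of the weight of an admissible T-vertex to which the colors outside `Q` do not
contribute. -/
def localFactor (t x y : A) (Q : Finset D) (l : D) (S : Finset D) (r : D) : A :=
  (∏ q ∈ Q, if q ∈ S then siteFactor t l r q else 1) * amplitude t x y l S r

/-- The contribution of the colors in `Q` to the weight of two T-vertices on top of each other. -/
def localPair (t x x' y : A) (Q : Finset D) (l l' : D) (S : Finset D) (r r' : D) : A :=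
  if Admissible l S r then
    localFactor t x y Q l S r * localFactor t x' y Q l' (nextSet l S r) r'
  else 0

/-- The weight of the R-vertex through which the labels `a`, `b` pass straight. -/
def diagWeight (t x x' : A) (a b : D) : A :=
  if a = b then if a = ⊥ then x' - t * x else x - t * x'
  else if a < b then t * (x - x') else x - x'

/-- The weight of the R-vertex that exchanges the distinct labels `a`, `b`. -/
def swapWeight (t x x' : A) (a b : D) : A :=
  if a = b then 0
  else if a = ⊥ then (1 - t) * x' else if b = ⊥ ∨ a < b then (1 - t) * x else (1 - t) * x'

/-- The multiplicity of the color `q` in the label `a`. -/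
def charge (a q : D) : ℕ := if a = q then 1 else 0

/-- Adding the colors `a`, `b` to `S` and removing `d`, `e` results in a set of colors. -/
def Balanced (a b : D) (S : Finset D) (d e : D) : Prop :=
  ∀ q, q ≠ ⊥ → charge d q + charge e q ≤ (if q ∈ S then 1 else 0) + charge a q + charge b q ∧
    (if q ∈ S then 1 else 0) + charge a q + charge b q ≤ 1 + charge d q + charge e q

set_option maxHeartbeats 8000000 in
/-- The Yang-Baxter equation for the contribution of the boundary colors, by cases on their relative
order and on their membership in `S`. -/
lemma local_yangBaxter (t x x' y : A) {a b d e : D} {S : Finset D} (hS : ⊥ ∉ S)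
    (H : Balanced a b S d e) :
    diagWeight t x x' a b * localPair t x x' y {a, b, d, e} a b S d e +
      swapWeight t x x' a b * localPair t x x' y {a, b, d, e} b a S d e =
    localPair t x' x y {a, b, d, e} b a S e d * diagWeight t x x' d e +
      localPair t x' x y {a, b, d, e} b a S d e * swapWeight t x x' e d := by
  rcases eq_or_ne_and_ne a ⊥ with rfl | ⟨_, _⟩ <;> rcases eq_or_ne_and_ne b ⊥ with rfl | ⟨_, _⟩ <;>
  rcases eq_or_ne_and_ne d ⊥ with rfl | ⟨_, _⟩ <;> rcases eq_or_ne_and_ne e ⊥ with rfl | ⟨_, _⟩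
  -- Here and below, `try` passes over branches in which an earlier substitution has removed one of
  -- the variables.
  all_goals
    try (have h := eq_or_ne_and_ne a b; rcases h with rfl | ⟨_, _⟩)
  all_goals
    try (have h := eq_or_ne_and_ne a d; rcases h with rfl | ⟨_, _⟩)
  all_goals
    try (have h := eq_or_ne_and_ne a e; rcases h with rfl | ⟨_, _⟩)
  all_goals
    try (have h := eq_or_ne_and_ne b d; rcases h with rfl | ⟨_, _⟩)
  all_goals
    try (have h := eq_or_ne_and_ne b e; rcases h with rfl | ⟨_, _⟩)
  all_goals
    try (have h := eq_or_ne_and_ne d e; rcases h with rfl | ⟨_, _⟩)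
  -- Balance at each colored label ties its membership in `S` to the coincidences; contradictory
  -- branches close here.
  all_goals
    try (by_cases hp : a ∈ S <;> have h := H a ‹_› <;> simp [charge, *] at h)
  all_goals
    try (by_cases hp : b ∈ S <;> have h := H b ‹_› <;> simp [charge, *] at h)
  all_goals
    try (by_cases hp : d ∈ S <;> have h := H d ‹_› <;> simp [charge, *] at h)
  all_goals
    try (by_cases hp : e ∈ S <;> have h := H e ‹_› <;> simp [charge, *] at h)
  all_goals
    try (have h := lt_and_not_gt_or (a := a) (b := b) ‹_›; rcases h with ⟨_, _⟩ | ⟨_, _⟩)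
  all_goals
    try (have h := lt_and_not_gt_or (a := a) (b := d) ‹_›; rcases h with ⟨_, _⟩ | ⟨_, _⟩)
  all_goals
    try (have h := lt_and_not_gt_or (a := b) (b := d) ‹_›; rcases h with ⟨_, _⟩ | ⟨_, _⟩)
  -- Intransitive patterns of comparisons are discarded before further splitting.
  all_goals first | (exfalso; order) | skip
  all_goals
    try (have h := lt_and_not_gt_or (a := a) (b := e) ‹_›; rcases h with ⟨_, _⟩ | ⟨_, _⟩)
  all_goals
    try (have h := lt_and_not_gt_or (a := b) (b := e) ‹_›; rcases h with ⟨_, _⟩ | ⟨_, _⟩)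
  all_goals
    try (have h := lt_and_not_gt_or (a := d) (b := e) ‹_›; rcases h with ⟨_, _⟩ | ⟨_, _⟩)
  all_goals first | (exfalso; order) | skip
  all_goals
    simp only [localPair, localFactor, prod_quadruple, Admissible, mem_nextSet, amplitude, siteFactor,
      leftFactor, rightFactor, diagWeight, swapWeight, bot_lt_iff_ne_bot, not_lt_bot, lt_irrefl,
      if_true, if_false, or_false, false_or, or_true, not_true, not_false_iff,
      and_true, and_false, ne_eq, *]
  all_goals ring

/-! ### Factoring out the colors off the boundary -/

/-- The Whittaker weight of an admissible T-vertex. -/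
def vertexFactor (t x y : A) (l : D) (S : Finset D) (r : D) : A :=
  (∏ q ∈ S, siteFactor t l r q) * amplitude t x y l S r

/-- The weight of two T-vertices on top of each other, when color conservation holds for the
pair as a whole. -/
def pairFactor (t x x' y : A) (l l' : D) (S : Finset D) (r r' : D) : A :=
  if Admissible l S r then
    vertexFactor t x y l S r * vertexFactor t x' y l' (nextSet l S r) r'
  else 0

lemma bot_notMem_nextSet {l r : D} {S : Finset D} (hS : ⊥ ∉ S) : ⊥ ∉ nextSet l S r := by
  rw [mem_nextSet]
  split_ifs <;> simp [hS]

/-- The exceptional case of `siteFactor` occurs only at `q = r`, so off `Q` the left and right parts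
separate. -/
lemma vertexFactor_eq (t x y : A) {l r : D} {S Q : Finset D} (hr : r ∈ Q) :
    vertexFactor t x y l S r =
      (∏ q ∈ S \ Q, leftFactor t l q) * (∏ q ∈ S \ Q, rightFactor r q) *
        localFactor t x y Q l S r := by
  rw [vertexFactor, localFactor, ← mul_assoc]
  congr 1
  rw [← Finset.prod_mul_distrib, ← Finset.prod_filter, Finset.filter_mem_eq_inter,
    Finset.inter_comm, mul_comm, ← Finset.prod_inter_mul_prod_sdiff S Q]
  congr 1
  refine Finset.prod_congr rfl fun q hq => ?_
  rw [siteFactor, if_neg]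
  rintro rfl
  exact (Finset.mem_sdiff.mp hq).2 hr

lemma nextSet_sdiff {l r : D} {S Q : Finset D} (hS : ⊥ ∉ S) (hl : l ∈ Q) (hr : r ∈ Q) :
    nextSet l S r \ Q = S \ Q := by
  ext q
  simp only [Finset.mem_sdiff, mem_nextSet]
  refine and_congr_left fun hq => ?_
  split_ifs
  · rfl
  · have h1 : q ≠ l := fun h => hq (h ▸ hl)
    have h2 : q ≠ r := fun h => hq (h ▸ hr)
    refine ⟨fun h => h.2.2.resolve_left h1, fun h => ⟨fun h0 => hS (h0 ▸ h), h2, Or.inr h⟩⟩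

lemma pairFactor_eq (t x x' y : A) {l l' r r' : D} {S Q : Finset D} (hS : ⊥ ∉ S)
    (hl : l ∈ Q) (hr : r ∈ Q) (hr' : r' ∈ Q) :
    pairFactor t x x' y l l' S r r' =
      (∏ q ∈ S \ Q, leftFactor t l q) * (∏ q ∈ S \ Q, leftFactor t l' q) *
        ((∏ q ∈ S \ Q, rightFactor r q) * (∏ q ∈ S \ Q, rightFactor r' q)) *
        localPair t x x' y Q l l' S r r' := by
  unfold pairFactor localPair
  split_ifs
  · rw [vertexFactor_eq t x y hr, vertexFactor_eq t x' y hr', nextSet_sdiff hS hl hr]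
    ring
  · rw [mul_zero]

lemma pair_yangBaxter (t x x' y : A) {a b d e : D} {S : Finset D} (hS : ⊥ ∉ S)
    (H : Balanced a b S d e) :
    diagWeight t x x' a b * pairFactor t x x' y a b S d e +
      swapWeight t x x' a b * pairFactor t x x' y b a S d e =
    pairFactor t x' x y b a S e d * diagWeight t x x' d e +
      pairFactor t x' x y b a S d e * swapWeight t x x' e d := by
  have ha : a ∈ ({a, b, d, e} : Finset D) := by simp
  have hb : b ∈ ({a, b, d, e} : Finset D) := by simp
  have hd : d ∈ ({a, b, d, e} : Finset D) := by simp
  have he : e ∈ ({a, b, d, e} : Finset D) := by simp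
  rw [pairFactor_eq t x x' y hS ha hd he, pairFactor_eq t x x' y hS hb hd he,
    pairFactor_eq t x' x y hS hb he hd, pairFactor_eq t x' x y hS hb hd he]
  generalize (∏ q ∈ S \ _, leftFactor t a q) = u
  generalize (∏ q ∈ S \ _, leftFactor t b q) = v
  generalize (∏ q ∈ S \ _, rightFactor d q : A) = w
  generalize (∏ q ∈ S \ _, rightFactor e q : A) = z
  linear_combination (u * v * w * z) * local_yangBaxter t x x' y hS H

/-- Expressing a vertex as an additive color count lets stacked vertices be combined by adding
equations. -/
lemma admissible_and_eq_nextSet_iff {l r : D} {S S' : Finset D} (hS : ⊥ ∉ S) (hS' : ⊥ ∉ S') :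
    (Admissible l S r ∧ S' = nextSet l S r) ↔
      ∀ q, q ≠ ⊥ → (if q ∈ S' then 1 else 0) + charge r q =
        (if q ∈ S then 1 else 0) + charge l q := by
  constructor
  · rintro ⟨h, rfl⟩ q hq
    simp only [mem_nextSet, charge]
    unfold Admissible at h
    by_cases hlr : l = r
    · simp [hlr]
    · by_cases h1 : l = q
      · subst h1
        simp_all [eq_comm]
      · by_cases h2 : r = q
        · subst h2
          simp_all [eq_comm]
        · simp [h1, h2, hlr, hq, Ne.symm h1, Ne.symm h2]
  · intro h
    have key : ∀ q, q ∈ S' ↔ q ∈ nextSet l S r := by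
      intro q
      rw [mem_nextSet]
      by_cases hq : q = ⊥
      · subst hq
        simp [hS, hS']
      · have := h q hq
        unfold charge at this
        split_ifs at this ⊢ <;> simp_all [eq_comm]
    refine ⟨?_, Finset.ext key⟩
    unfold Admissible
    by_cases hlr : l = r
    · exact Or.inl hlr
    · refine Or.inr ⟨fun hl => ?_, ?_⟩
      · have := h l (fun h0 => hS (h0 ▸ hl))
        simp only [charge, hl, if_true, if_neg (Ne.symm hlr)] at this
        split_ifs at this <;> omega
      · by_cases hr : r = ⊥
        · exact Or.inl hr
        · right
          have := h r hr
          simp only [charge, if_true, if_neg hlr] at this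
          by_contra hrS
          simp [hrS] at this

end Local

/-! ### Translation of the weight tables into factored form -/

section Labels

variable {C : Type*}

/-- The label of a horizontal edge, with `+` placed below all colors. -/
def label (l : Option C) : WithBot C := l

/-- The colors of a vertical edge among the labels of horizontal edges. -/
def labels (S : Finset C) : Finset (WithBot C) := S.map ⟨WithBot.some, WithBot.coe_injective⟩

lemma bot_notMem_labels (S : Finset C) : ⊥ ∉ labels S := by simp [labels]

lemma coe_mem_labels {S : Finset C} {c : C} : (c : WithBot C) ∈ labels S ↔ c ∈ S := by
  simp [labels]

lemma labels_injective : Function.Injective (labels : Finset C → Finset (WithBot C)) :=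
  Finset.map_injective _

lemma label_none : label (none : Option C) = ⊥ := rfl

lemma label_some (c : C) : label (some c) = (c : WithBot C) := rfl

lemma prod_labels {A : Type*} [CommRing A] (S : Finset C) (f : WithBot C → A) :
    ∏ q ∈ labels S, f q = ∏ c ∈ S, f c := by
  simp [labels]

lemma pow_card_filter {A : Type*} [CommRing A] (S : Finset C) (p : C → Prop) [DecidablePred p]
    (z : A) : z ^ (S.filter p).card = ∏ c ∈ S, if p c then z else 1 := by
  rw [← Finset.prod_filter, Finset.prod_const]

end Labels

variable {C : Type*} [LinearOrder C] {A : Type*} [CommRing A]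

lemma rWeight_eq (t x x' : A) (a b u v : Option C) :
    rWeight t x x' a b u v =
      (if u = a ∧ v = b then diagWeight t x x' (label a) (label b) else 0) +
      (if u = b ∧ v = a then swapWeight t x x' (label a) (label b) else 0) := by
  rcases a with _ | a <;> rcases b with _ | b <;> rcases u with _ | u <;> rcases v with _ | v <;>
    simp [rWeight, diagWeight, swapWeight, label_none, label_some, eq_comm]
  by_cases hab : a = b
  · subst hab
    simp
  · by_cases h1 : a = u ∧ b = v
    · obtain ⟨rfl, rfl⟩ := h1
      simp [hab, Ne.symm hab]
    · simp [hab, h1]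

lemma labels_eq_iff {l r : Option C} {S S' : Finset C} (h : label l ≠ label r) :
    labels S' = nextSet (label l) (labels S) (label r) ↔
      S' = (S ∪ l.toFinset) \ r.toFinset := by
  rw [Finset.ext_iff, Finset.ext_iff, WithBot.forall]
  simp only [mem_nextSet, if_neg h, bot_notMem_labels, coe_mem_labels]
  rcases l with _ | l <;> rcases r with _ | r <;>
    simp [label_none, label_some, eq_comm, or_comm, and_comm]

/-- A color below both labels gets two cancelling signs, and one above both gets `t`. One strictly
between gets `-t` if the left label is the smaller and `-1` otherwise, which gives the powers in the
table. -/
lemma whittakerWeight_eq (t x y : A) (l : Option C) (S : Finset C) (r : Option C) (S' : Finset C) :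
    whittakerWeight t x y l S r S' =
      if Admissible (label l) (labels S) (label r) ∧
        labels S' = nextSet (label l) (labels S) (label r)
      then vertexFactor t x y (label l) (labels S) (label r) else 0 := by
  rcases l with _ | c <;> rcases r with _ | d
  · have h : Admissible (label (none : Option C)) (labels S) (label none) := Or.inl rfl
    simp only [h, true_and, nextSet, if_true, labels_injective.eq_iff, whittakerWeight]
    congr 1
    simp [vertexFactor, amplitude, prod_labels, siteFactor, leftFactor, rightFactor, label_none]
  · have hne : label none ≠ label (some d) := WithBot.bot_ne_coe
    have h : Admissible (label none) (labels S) (label (some d)) ↔ d ∈ S := by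
      simp [Admissible, label_none, label_some, coe_mem_labels, bot_notMem_labels]
    simp only [labels_eq_iff hne, h]
    simp only [whittakerWeight]
    refine if_congr (by simp [Finset.sdiff_singleton_eq_erase]) ?_ rfl
    simp only [numBelow, numAbove, pow_card_filter, vertexFactor, amplitude, prod_labels, label_none,
      label_some, if_true, mul_one, ← Finset.prod_mul_distrib]
    refine Finset.prod_congr rfl fun q _ => ?_
    rcases lt_trichotomy d q with h | rfl | h
    · simp [siteFactor, leftFactor, rightFactor, h, h.not_gt, h.ne]
    · simp [siteFactor]
    · simp [siteFactor, leftFactor, rightFactor, h, h.not_gt, h.ne']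
  · have hne : label (some c) ≠ label none := WithBot.coe_ne_bot
    have h : Admissible (label (some c)) (labels S) (label none) ↔ c ∉ S := by
      simp [Admissible, label_none, label_some, coe_mem_labels]
    simp only [labels_eq_iff hne, h]
    simp only [whittakerWeight]
    refine ite_congr (by simp [Finset.union_comm S]) (fun hc => ?_) fun _ => rfl
    simp only [numAbove, pow_card_filter, vertexFactor, amplitude, prod_labels, label_none,
      label_some, WithBot.coe_ne_bot, if_false, true_or, if_true]
    rw [mul_comm]
    congr 1
    refine Finset.prod_congr rfl fun q hq => ?_
    rcases lt_trichotomy c q with h | rfl | h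
    · simp [siteFactor, leftFactor, rightFactor, h]
    · exact absurd hq hc.1
    · simp [siteFactor, leftFactor, rightFactor, h, h.not_gt]
  · by_cases hcd : c = d
    · subst hcd
      have h : Admissible (label (some c)) (labels S) (label (some c)) := Or.inl rfl
      simp only [h, true_and, nextSet, if_true, labels_injective.eq_iff, whittakerWeight]
      congr 1
      simp only [numAbove, mult, pow_card_filter, vertexFactor, amplitude, prod_labels, label_some,
        WithBot.coe_ne_bot, if_false, if_true, coe_mem_labels]
      congr 1
      · refine Finset.prod_congr rfl fun q _ => ?_
        rcases lt_trichotomy c q with h | rfl | h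
        · simp [siteFactor, leftFactor, rightFactor, h, h.not_gt, h.ne]
        · simp [siteFactor]
        · simp [siteFactor, leftFactor, rightFactor, h, h.not_gt, h.ne']
      · split_ifs <;> simp
    · have hne : label (some c) ≠ label (some d) := fun h => hcd (WithBot.coe_injective h)
      have h : Admissible (label (some c)) (labels S) (label (some d)) ↔ c ∉ S ∧ d ∈ S := by
        simp [Admissible, label_some, coe_mem_labels, hcd]
      simp only [labels_eq_iff hne, h]
      simp only [whittakerWeight, if_neg hcd]
      refine ite_congr (by simp [and_assoc, Finset.union_comm S,
        Finset.sdiff_singleton_eq_erase]) (fun hc => ?_) fun _ => rfl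
      simp only [numAbove, numBetween, pow_card_filter, vertexFactor, amplitude, prod_labels,
        label_some, WithBot.coe_ne_bot, if_false, false_or, WithBot.coe_lt_coe,
        WithBot.coe_inj, if_neg hcd]
      split_ifs with hlt
      · rw [mul_assoc, mul_comm, ← Finset.prod_mul_distrib]
        congr 1
        refine Finset.prod_congr rfl fun q hq => ?_
        have hqc : c ≠ q := fun h => hc.1.1 (h ▸ hq)
        rcases lt_trichotomy d q with h | rfl | h
        · simp [siteFactor, leftFactor, rightFactor, h, h.not_gt, h.ne, hlt.trans h]
        · simp [siteFactor]
        · rcases hqc.lt_or_gt with h' | h' <;>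
            simp [siteFactor, leftFactor, rightFactor, h, h.not_gt, h.ne', h', h'.not_gt]
      · have hlt : d < c := lt_of_le_of_ne (not_lt.mp hlt) (Ne.symm hcd)
        rw [mul_assoc, mul_comm, ← Finset.prod_mul_distrib]
        congr 1
        refine Finset.prod_congr rfl fun q hq => ?_
        have hqc : c ≠ q := fun h => hc.1.1 (h ▸ hq)
        rcases lt_trichotomy d q with h | rfl | h
        · rcases hqc.lt_or_gt with h' | h' <;>
            simp [siteFactor, leftFactor, rightFactor, h, h.not_gt, h.ne, h', h'.not_gt]
        · simp [siteFactor, hlt.not_gt]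
        · simp [siteFactor, leftFactor, rightFactor, h, h.not_gt, h.ne', h.trans hlt,
            (h.trans hlt).not_gt]

lemma kTheoreticWeight_eq (t x : A) (y : Aˣ) (l : Option C) (S : Finset C) (r : Option C)
    (S' : Finset C) :
    kTheoreticWeight t x y l S r S' =
      (if l = none then 1 else -((y⁻¹ : Aˣ) : A)) * whittakerWeight t x (-(y : A)) l S r S' := by
  have hy : ((y⁻¹ : Aˣ) : A) * y = 1 := y.inv_mul
  rcases l with _ | c
  · rcases r with _ | d <;> simp only [kTheoreticWeight, whittakerWeight, if_true, one_mul]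
  rcases r with _ | d <;>
    simp only [kTheoreticWeight, whittakerWeight, reduceCtorEq, if_false, mul_ite, mul_zero]
  · refine if_congr Iff.rfl ?_ rfl
    ring
  · refine if_congr Iff.rfl (if_congr Iff.rfl ?_ rfl)
      (if_congr Iff.rfl (if_congr Iff.rfl ?_ ?_) rfl)
    · linear_combination -(t ^ numAbove S c * t ^ mult S c) * hy
    · ring
    · linear_combination -((t - 1) * (-1) ^ numBetween S d c * t ^ numAbove S c) * hy

/-! ### Summation over interior edges and the Yang–Baxter equation -/

/-- The colors entering two T-vertices on top of each other are those leaving them. -/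
def Conserved {D : Type*} [LinearOrder D] [OrderBot D] (a b : D) (S : Finset D) (d e : D)
    (S' : Finset D) : Prop :=
  ∀ q, q ≠ ⊥ → (if q ∈ S' then 1 else 0) + charge d q + charge e q =
    (if q ∈ S then 1 else 0) + charge a q + charge b q

/-- Multiplicities in `S'` are 0 or 1, so eliminating `S'` leaves two inequalities. -/
lemma Conserved.balanced {D : Type*} [LinearOrder D] [OrderBot D] {a b d e : D} {S S' : Finset D}
    (h : Conserved a b S d e S') : Balanced a b S d e := by
  intro q hq
  have := h q hq
  split_ifs at this ⊢ <;> omega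

lemma conserved_swap_left {D : Type*} [LinearOrder D] [OrderBot D] {a b d e : D}
    {S S' : Finset D} : Conserved b a S d e S' ↔ Conserved a b S d e S' :=
  forall₂_congr fun q _ => by rw [add_right_comm _ (charge b q)]

lemma conserved_swap_right {D : Type*} [LinearOrder D] [OrderBot D] {a b d e : D}
    {S S' : Finset D} : Conserved a b S e d S' ↔ Conserved a b S d e S' :=
  forall₂_congr fun q _ => by rw [add_right_comm _ (charge e q)]

variable [Fintype C]

lemma exists_labels_eq {S : Finset (WithBot C)} (hS : ⊥ ∉ S) : ∃ m : Finset C, labels m = S := by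
  refine ⟨Finset.univ.filter fun c : C => (c : WithBot C) ∈ S, ?_⟩
  ext q
  induction q using WithBot.recBotCoe with
  | bot => simp [hS, bot_notMem_labels]
  | coe c => simp [coe_mem_labels]

-- The upper vertex determines `m`; subtracting its conservation law from that of the pair gives the
-- law of the lower vertex.
open Classical in
lemma sum_whittakerWeight_mul (t x x' y : A) (l l' : Option C) (S : Finset C) (r r' : Option C)
    (S' : Finset C) :
    ∑ m : Finset C, whittakerWeight t x y l S r m * whittakerWeight t x' y l' m r' S' =
      if Conserved (label l) (label l') (labels S) (label r) (label r') (labels S') then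
        pairFactor t x x' y (label l) (label l') (labels S) (label r) (label r') else 0 := by
  simp only [whittakerWeight_eq]
  by_cases h : Admissible (label l) (labels S) (label r)
  · obtain ⟨m, hm⟩ := exists_labels_eq
      (bot_notMem_nextSet (l := label l) (r := label r) (bot_notMem_labels S))
    have hstep := (admissible_and_eq_nextSet_iff (bot_notMem_labels S) (bot_notMem_labels m)).mp
      ⟨h, hm⟩
    rw [Finset.sum_eq_single m]
    · rw [if_pos ⟨h, hm⟩, pairFactor, if_pos h, ← hm, mul_ite, mul_zero]
      refine if_congr ?_ rfl rfl
      rw [admissible_and_eq_nextSet_iff (bot_notMem_labels m) (bot_notMem_labels S')]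
      refine forall₂_congr fun q hq => ?_
      have := hstep q hq
      omega
    · intro m' _ hne
      rw [if_neg, zero_mul]
      rintro ⟨_, hm'⟩
      exact hne (labels_injective (hm'.trans hm.symm))
    · exact fun hm => absurd (Finset.mem_univ m) hm
  · simp [h, pairFactor]

lemma sum_rWeight_mul (t x x' : A) (a b : Option C) (g : Option C → Option C → A) :
    ∑ u, ∑ v, rWeight t x x' a b u v * g u v =
      diagWeight t x x' (label a) (label b) * g a b +
        swapWeight t x x' (label a) (label b) * g b a := by
  simp only [rWeight_eq, add_mul, Finset.sum_add_distrib, ite_and, ite_mul, zero_mul,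
    Finset.sum_ite_irrel, Finset.sum_ite_eq', Finset.mem_univ, if_true, Finset.sum_const_zero]

lemma sum_mul_rWeight (t x x' : A) (d e : Option C) (g : Option C → Option C → A) :
    ∑ u, ∑ v, g u v * rWeight t x x' u v d e =
      g d e * diagWeight t x x' (label d) (label e) +
        g e d * swapWeight t x x' (label e) (label d) := by
  have h (u v : Option C) : g u v * rWeight t x x' u v d e =
      (if u = d then if v = e then g d e * diagWeight t x x' (label d) (label e) else 0 else 0) +
      (if u = e then if v = d then g e d * swapWeight t x x' (label e) (label d) else 0 else 0) := by
    rw [rWeight_eq, mul_add, mul_ite, mul_ite, mul_zero, ← ite_and, ← ite_and]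
    refine congr_arg₂ (· + ·) (ite_congr (by simp [eq_comm]) ?_ fun _ => rfl)
      (ite_congr (by simp [eq_comm, and_comm]) ?_ fun _ => rfl)
    · rintro ⟨rfl, rfl⟩
      rfl
    · rintro ⟨rfl, rfl⟩
      rfl
  simp only [h, Finset.sum_add_distrib, Finset.sum_ite_irrel, Finset.sum_ite_eq', Finset.mem_univ,
    if_true, Finset.sum_const_zero]

theorem whittaker_yangBaxter (t x x' y : A) :
    YangBaxter (C := C) (rWeight t x x') (whittakerWeight t x y) (whittakerWeight t x' y) := by
  classical
  intro a b S d e S'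
  unfold leftPartition rightPartition
  simp only [mul_assoc (rWeight t x x' _ _ _ _), ← Finset.mul_sum, ← Finset.sum_mul,
    sum_whittakerWeight_mul, sum_rWeight_mul, sum_mul_rWeight]
  -- The conservation conditions of the four terms differ only by the order of labels and become one
  -- condition.
  simp only [conserved_swap_left (a := label a) (b := label b),
    conserved_swap_right (d := label d) (e := label e)]
  by_cases h : Conserved (label a) (label b) (labels S) (label d) (label e) (labels S')
  · simp only [if_pos h]
    exact pair_yangBaxter t x x' y (bot_notMem_labels S) h.balanced
  · simp only [if_neg h, mul_zero, zero_mul]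

/-- Multiplying the weights of all T-vertices by a factor that depends on the left label preserves
the Yang-Baxter equation, as the R-vertex permutes the labels. -/
lemma YangBaxter.gauge {t x x' : A} {T₁ T₂ : Option C → Finset C → Option C → Finset C → A}
    (h : YangBaxter (rWeight t x x') T₁ T₂) (φ : Option C → A) :
    YangBaxter (rWeight t x x') (fun l S r S' => φ l * T₁ l S r S')
      (fun l S r S' => φ l * T₂ l S r S') := by
  intro a b S d e S'
  have key := congr_arg (φ a * φ b * ·) (h a b S d e S')
  simp only [leftPartition, rightPartition, Finset.mul_sum] at key ⊢
  have hl (u v : Option C) : rWeight t x x' a b u v * (φ u * φ v) =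
      φ a * φ b * rWeight t x x' a b u v := by
    rw [rWeight_eq]
    split_ifs with h₁ h₂ h₂
    · rw [h₁.1, h₁.2]; ring
    · rw [h₁.1, h₁.2]; ring
    · rw [h₂.1, h₂.2]; ring
    · ring
  refine Eq.trans ?_ (key.trans ?_) <;>
    refine Finset.sum_congr rfl fun u _ => Finset.sum_congr rfl fun v _ =>
      Finset.sum_congr rfl fun m _ => ?_
  · linear_combination (T₁ u S d m * T₂ v m e S') * hl u v
  · ring

end ColoredLattice

theorem theorem3p3 {C : Type*} [Fintype C] [LinearOrder C] {A : Type*} [CommRing A]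
    (t xi xj : A) :
    (∀ y : A, ColoredLattice.YangBaxter (C := C)
      (ColoredLattice.rWeight t xi xj)
      (ColoredLattice.whittakerWeight t xi y)
      (ColoredLattice.whittakerWeight t xj y)) ∧
    (∀ y : Aˣ, ColoredLattice.YangBaxter (C := C)
      (ColoredLattice.rWeight t xi xj)
      (ColoredLattice.kTheoreticWeight t xi y)
      (ColoredLattice.kTheoreticWeight t xj y)) := by
  refine ⟨ColoredLattice.whittaker_yangBaxter t xi xj, fun y => ?_⟩
  have h (x : A) : ColoredLattice.kTheoreticWeight (C := C) t x y = fun l S r S' =>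
      (if l = none then 1 else -((y⁻¹ : Aˣ) : A)) *
        ColoredLattice.whittakerWeight t x (-(y : A)) l S r S' := by
    funext l S r S'
    exact ColoredLattice.kTheoreticWeight_eq t x y l S r S'
  rw [h, h]
  exact (ColoredLattice.whittaker_yangBaxter t xi xj (-(y : A))).gauge _
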